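/- Let $G$ be a $\sigma$-compact, locally compact topological group which is amenable, i.e. for a left Haar measure $\lambda$ of $G$, every compact $K\subset G$ and every $\varepsilon>0$ there is a Borel set $F\subset G$ with $0<\lambda(F)<\infty$ and $\lambda(gF\,\Delta\,F)/\lambda(F)<\varepsilon$ for all $g\in K$. For actions $\alpha,\beta$ of $G$ on metric spaces $(X,d_X),(Y,d_Y)$ and $\varepsilon>0$, an $\varepsilon$-GH approximation from $\alpha$ to $\beta$ is a map $f:X\to Y$ (not necessarily continuous) such that $|d_Y(f(x_1),f(x_2))-d_X(x_1,x_2)|\le\varepsilon$ for all $x_1,x_2\in X$, every point of $Y$ is within distance $\varepsilon$ of $f(X)$, and $d_Y(\beta_g f(x),f(\alpha_g x))\le\varepsilon$ for all $g\in G$, $x\in X$. Let $d_{GH}(\alpha,\beta)\in[0,\infty]$ be the infimum of those $\varepsilon>0$ for which there exist $\varepsilon$-GH approximations from $\alpha$ to $\beta$ and from $\beta$ to $\alpha$. For $p\ge 1$ and a compact metric space $(X,d)$ with an action of $G$, let $P_p^G(X)$ be the set of $G$-invariant Borel probability measures $\mu$ on $X$ (with finite $p$-th moment, which is automatic since $X$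 is compact), with the Wasserstein distance $$W_p(\mu,\nu)=\Big(\inf_{\pi}\int_{X\times X}d(x,y)^p\,d\pi(x,y)\Big)^{1/p},$$ where $\pi$ runs over the Borel probability measures on $X\times X$ with marginals $\mu$ and $\nu$. Let $\operatorname{diam}(P_p^G(X))$ be its diameter with respect to $W_p$. Let $(\alpha_n)_{n\in\mathbb N}$ be a sequence of isometric actions of $G$ on compact metric spaces $(X_n,d_n)$, and let $\alpha$ be an action of $G$ on a compact metric space $(X,d)$ such that $\lim_{n\to\infty}d_{GH}(\alpha_n,\alpha)=0$. If $\alpha$ is uniquely ergodic, i.e. there is exactly one $G$-invariant Borel probability measure on $X$, then $$\lim_{n\to\infty}\operatorname{diam}\big(P_p^G(X_n)\big)=0\qquad\text{for every } p\ge 1.$$ -/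

import Mathlib

open MeasureTheory Filter Topology
open scoped ENNReal

namespace EquivariantGH

/-- Følner's condition for a locally compact group `G`, with respect to a left Haar measure `haar`
(a left-invariant Radon measure; the condition does not depend on the choice, since left Haar
measures are unique up to a positive factor): for every compact `K ⊆ G` and every `ε > 0` there is
a Borel set `F` with `0 < haar F < ∞` and `haar (gF ∆ F) / haar F < ε` for all `g ∈ K`. -/
def IsAmenable (G : Type*) [Group G] [TopologicalSpace G] [MeasurableSpace G] : Prop :=
  ∃ haar : Measure G, haar.IsHaarMeasure ∧ haar.Regular ∧
    ∀ K : Set G, IsCompact K → ∀ ε : ℝ, 0 < ε →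
      ∃ F : Set G, MeasurableSet F ∧ 0 < haar F ∧ haar F < ∞ ∧
        ∀ g ∈ K, haar (symmDiff ((fun x => g * x) '' F) F) / haar F < ENNReal.ofReal ε

/-- `f : X → Y` is an `ε`-isometry: it distorts distances by at most `ε`, and every point of `Y`
is within distance `ε` of `f(X)`. -/
structure IsEpsIsometry {X Y : Type*} [MetricSpace X] [MetricSpace Y]
    (ε : ℝ) (f : X → Y) : Prop where
  abs_dist_sub_le : ∀ x₁ x₂ : X, |dist (f x₁) (f x₂) - dist x₁ x₂| ≤ ε
  exists_dist_le : ∀ y : Y, ∃ x : X, dist y (f x) ≤ ε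

/-- `f : X → Y` is an `ε`-GH approximation from the action of `G` on `X` to the action of `G`
on `Y`: an `ε`-isometry with `sup_x d(g f(x), f(g x)) ≤ ε` for every `g ∈ G`. -/
structure IsGHApprox (G : Type*) [Group G] {X Y : Type*} [MetricSpace X] [MetricSpace Y]
    [MulAction G X] [MulAction G Y] (ε : ℝ) (f : X → Y) : Prop extends IsEpsIsometry ε f where
  dist_smul_le : ∀ (g : G) (x : X), dist (g • f x) (f (g • x)) ≤ ε

/-- The equivariant Gromov-Hausdorff distance `d_GH(α, β)` between the actions of `G` on `X`
and on `Y`: the infimum of the `ε > 0` for which there are `ε`-GH approximations in both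
directions (and `∞` if there are none). -/
noncomputable def ghDist (G : Type*) [Group G] (X Y : Type*) [MetricSpace X] [MetricSpace Y]
    [MulAction G X] [MulAction G Y] : ℝ≥0∞ :=
  ⨅ (ε : ℝ) (_ : 0 < ε ∧ (∃ f : X → Y, IsGHApprox G ε f) ∧ (∃ h : Y → X, IsGHApprox G ε h)),
    ENNReal.ofReal ε

/-- An action is uniquely ergodic if it has exactly one invariant Borel probability measure. -/
def UniquelyErgodic (G : Type*) [Group G] (X : Type*) [MeasurableSpace X] [MulAction G X] : Prop :=
  ∃! μ : ProbabilityMeasure X, SMulInvariantMeasure G X (μ : Measure X)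

/-- `P_p(X)`: the Borel probability measures on `X` with finite `p`-th moment. -/
def wassersteinSpace (p : ℝ) (X : Type*) [MetricSpace X] [MeasurableSpace X] :
    Set (ProbabilityMeasure X) :=
  {μ | ∃ x₀ : X, ∫⁻ x, edist x x₀ ^ p ∂(μ : Measure X) < ∞}

/-- `P_p^G(X)`: the `G`-invariant measures in `P_p(X)`. -/
def invariantWassersteinSpace (p : ℝ) (G : Type*) [Group G] (X : Type*) [MetricSpace X]
    [MeasurableSpace X] [MulAction G X] : Set (ProbabilityMeasure X) :=
  {μ | μ ∈ wassersteinSpace p X ∧ SMulInvariantMeasure G X (μ : Measure X)}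

/-- The couplings of `μ` and `ν`: probability measures on `X × X` with marginals `μ` and `ν`. -/
def couplings {X : Type*} [MeasurableSpace X] (μ ν : ProbabilityMeasure X) :
    Set (ProbabilityMeasure (X × X)) :=
  {π | (π : Measure (X × X)).map Prod.fst = μ ∧ (π : Measure (X × X)).map Prod.snd = ν}

/-- The Wasserstein distance `W_p(μ, ν) = (inf_π ∫ d(x, y)^p dπ(x, y))^(1/p)`, the infimum being
over the couplings `π` of `μ` and `ν`. -/
noncomputable def wassersteinDist (p : ℝ) {X : Type*} [MetricSpace X] [MeasurableSpace X]
    (μ ν : ProbabilityMeasure X) : ℝ≥0∞ :=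
  (⨅ π ∈ couplings μ ν, ∫⁻ z, edist z.1 z.2 ^ p ∂(π : Measure (X × X))) ^ (1 / p)

/-- The diameter of a set of probability measures with respect to `W_p`. -/
noncomputable def wassersteinDiam (p : ℝ) {X : Type*} [MetricSpace X] [MeasurableSpace X]
    (P : Set (ProbabilityMeasure X)) : ℝ≥0∞ :=
  ⨆ μ ∈ P, ⨆ ν ∈ P, wassersteinDist p μ ν

end EquivariantGH

/-!
The statement reduces to compact groups. An action of `G` by isometries on a compact metric space
`X` factors through the isometry group of `X`, which is compact in the topology of pointwise
convergence; let `K` be the closure of the image of `G`. Every `G`-invariant probability measure is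
`K`-invariant (`smulInvariantMeasure_actionClosure`), and `K` carries a Haar probability measure.

* The limit action on `Y` is isometric, because a Gromov-Hausdorff approximation `Y → X n`
  transports the isometric action of `G` on `X n` back to `Y` up to an arbitrarily small error
  (`isIsometricSMul_of_isGHApprox`).
* The image of Haar measure under `k ↦ k • y` is an invariant measure carried by the compact orbit
  of `y`. If `Y` is uniquely ergodic, all these orbit measures coincide, so the closure group acts
  transitively on `Y` and every `G`-orbit in `Y` is dense (`UniquelyErgodic.exists_dist_smul_lt`).
* An `ε`-approximation `X n → Y` turns this into: every `G`-orbit in `X n` is `4ε`-dense.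
* If every orbit of a compact group `K` of isometries is `δ`-dense, choose measurably
  `γ (x, x') ∈ K` with `d(γ (x, x') x, x') < δ`. For invariant `μ` and `ν`, the law of
  `(k⁻¹ γ (x, x') x, k⁻¹ x')` with `k` Haar distributed and `(x, x')` distributed as `μ × ν` is a
  coupling of `μ` and `ν` carried by pairs at distance at most `δ` (`exists_mem_couplings_dist_le`),
  so `W_p(μ, ν) ≤ δ`.
-/

namespace EquivariantGH

/-! ### The isometry group of a compact metric space -/

section IsometryGroup

variable {X : Type*} [MetricSpace X]

/-- An isometry together with its inverse, as a pair of plain functions. -/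
def isometryPair (f : X ≃ᵢ X) : (X → X) × (X → X) := (f, f.symm)

/-- The topology of pointwise convergence of an isometry and of its inverse. Including the inverse
makes inversion continuous by definition; on isometries it does not change the topology. -/
instance : TopologicalSpace (X ≃ᵢ X) := .induced isometryPair inferInstance

instance : MeasurableSpace (X ≃ᵢ X) := borel _

instance : BorelSpace (X ≃ᵢ X) := ⟨rfl⟩

instance : MulAction (X ≃ᵢ X) X where
  smul f x := f x
  one_smul _ := rfl
  mul_smul _ _ _ := rfl

theorem isEmbedding_isometryPair : IsEmbedding (isometryPair (X := X)) :=
  ⟨⟨rfl⟩, fun _ _ h => IsometryEquiv.ext fun x => congrFun (congrArg Prod.fst h) x⟩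

theorem continuous_isometryEquiv_apply (x : X) : Continuous fun f : X ≃ᵢ X => f x :=
  (continuous_apply x).comp (continuous_fst.comp isEmbedding_isometryPair.continuous)

theorem continuous_isometryEquiv_symm_apply (x : X) : Continuous fun f : X ≃ᵢ X => f.symm x :=
  (continuous_apply x).comp (continuous_snd.comp isEmbedding_isometryPair.continuous)

theorem continuous_isometryEquiv_iff {Z : Type*} [TopologicalSpace Z] {u : Z → (X ≃ᵢ X)} :
    Continuous u ↔ (∀ x, Continuous fun z => u z x) ∧ ∀ x, Continuous fun z => (u z).symm x := by
  rw [isEmbedding_isometryPair.continuous_iff, continuous_prodMk, continuous_pi_iff,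
    continuous_pi_iff]
  rfl

/-- Evaluation is jointly continuous because isometries are uniformly equicontinuous. -/
instance : ContinuousSMul (X ≃ᵢ X) X where
  continuous_smul := by
    rw [continuous_iff_continuousAt]
    rintro ⟨f, x⟩
    rw [ContinuousAt, tendsto_iff_dist_tendsto_zero]
    have h₁ : Tendsto (fun p : (X ≃ᵢ X) × X => dist p.2 x + dist (p.1 x) (f x))
        (𝓝 (f, x)) (𝓝 0) := by
      have : Continuous fun p : (X ≃ᵢ X) × X => dist p.2 x + dist (p.1 x) (f x) :=
        (continuous_snd.dist continuous_const).add
          (((continuous_isometryEquiv_apply x).comp continuous_fst).dist continuous_const)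
      simpa using this.tendsto (f, x)
    refine squeeze_zero (fun _ => dist_nonneg) (fun p => ?_) h₁
    calc dist (p.1 p.2) (f x) ≤ dist (p.1 p.2) (p.1 x) + dist (p.1 x) (f x) := dist_triangle _ _ _
      _ = dist p.2 x + dist (p.1 x) (f x) := by rw [p.1.dist_eq]

instance : IsTopologicalGroup (X ≃ᵢ X) where
  continuous_mul := by
    refine continuous_isometryEquiv_iff.2 ⟨fun x => ?_, fun x => ?_⟩
    · exact continuous_fst.smul ((continuous_isometryEquiv_apply x).comp continuous_snd)
    · have hinv : Continuous fun f : X ≃ᵢ X => f.symm :=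
        continuous_isometryEquiv_iff.2
          ⟨continuous_isometryEquiv_symm_apply, continuous_isometryEquiv_apply⟩
      exact (hinv.comp continuous_snd).smul
        ((continuous_isometryEquiv_symm_apply x).comp continuous_fst)
  continuous_inv := continuous_isometryEquiv_iff.2
    ⟨continuous_isometryEquiv_symm_apply, continuous_isometryEquiv_apply⟩

instance : IsIsometricSMul (X ≃ᵢ X) X := ⟨fun f => f.isometry⟩

instance : T2Space (X ≃ᵢ X) := isEmbedding_isometryPair.t2Space

/-- Surjectivity is not a closed condition on pointwise limits, but being inverse to each other
is: for isometries it says `d(f' x, y) = d(x, f y)` for all `x` and `y`. -/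
theorem isClosed_range_isometryPair : IsClosed (Set.range (isometryPair (X := X))) := by
  have h : Set.range (isometryPair (X := X)) =
      {p | ∀ x y, dist (p.1 x) (p.1 y) = dist x y ∧ dist (p.2 x) y = dist x (p.1 y)} := by
    ext ⟨f, f'⟩
    constructor
    · rintro ⟨e, he⟩
      cases he
      intro x y
      refine ⟨e.dist_eq x y, ?_⟩
      rw [← e.dist_eq (e.symm x) y, e.apply_symm_apply]
    · intro h
      have hr : ∀ x, f (f' x) = x := fun x => by
        have := (h x (f' x)).2
        rw [dist_self] at this
        exact (dist_eq_zero.1 this.symm).symm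
      have hl : ∀ x, f' (f x) = x := fun x => by
        have := (h (f x) x).2
        rw [dist_self] at this
        exact dist_eq_zero.1 this
      exact ⟨⟨⟨f, f', hl, hr⟩, Isometry.of_dist_eq fun x y => (h x y).1⟩, rfl⟩
  rw [h]
  simp only [Set.ofPred_forall, Set.ofPred_and]
  refine isClosed_iInter fun x => isClosed_iInter fun y => IsClosed.inter ?_ ?_
  · exact isClosed_eq (by fun_prop) (by fun_prop)
  · exact isClosed_eq (by fun_prop) (by fun_prop)

variable [CompactSpace X]

instance : CompactSpace (X ≃ᵢ X) :=
  IsClosedEmbedding.compactSpace ⟨isEmbedding_isometryPair, isClosed_range_isometryPair⟩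

/-- An isometry is determined by its values on a countable dense set, so the isometry group embeds
in a countable power of `X`. -/
instance : SecondCountableTopology (X ≃ᵢ X) := by
  obtain ⟨s, hs, hd⟩ := TopologicalSpace.exists_countable_dense X
  have := hs.to_subtype
  have hc : Continuous fun (f : X ≃ᵢ X) (i : s) => f i :=
    continuous_pi fun i => continuous_isometryEquiv_apply (i : X)
  refine (hc.isClosedEmbedding fun f g h => ?_).isEmbedding.secondCountableTopology
  refine IsometryEquiv.ext (congrFun (f.continuous.ext_on hd g.continuous fun x hx => ?_))
  exact congrFun h ⟨x, hx⟩

end IsometryGroup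

/-! ### The closure of an isometric action -/

section ActionClosure

variable (G : Type*) [Group G] (X : Type*) [MetricSpace X] [MulAction G X] [IsIsometricSMul G X]

/-- An isometric action as a homomorphism to the isometry group. -/
def toIsometryEquiv : G →* (X ≃ᵢ X) where
  toFun := IsometryEquiv.constSMul
  map_one' := IsometryEquiv.ext fun x => one_smul G x
  map_mul' g h := IsometryEquiv.ext fun x => mul_smul g h x

/-- The closure in the isometry group of the image of an isometric action. -/
def actionClosure : Subgroup (X ≃ᵢ X) := (toIsometryEquiv G X).range.topologicalClosure

instance [CompactSpace X] : CompactSpace (actionClosure G X) :=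
  isCompact_iff_compactSpace.1 (Subgroup.isClosed_topologicalClosure _).isCompact

instance : IsIsometricSMul (actionClosure G X) X := ⟨fun k => (k : X ≃ᵢ X).isometry⟩

instance [CompactSpace X] : SecondCountableTopology (actionClosure G X) :=
  TopologicalSpace.Subtype.secondCountableTopology _

variable {G} in
/-- An element of `G` as an element of the closure of its action. -/
def toActionClosure (g : G) : actionClosure G X :=
  ⟨toIsometryEquiv G X g, Subgroup.le_topologicalClosure _ ⟨g, rfl⟩⟩

variable {G X}

/-- A closed condition on isometries that holds on `G` holds on the closure of the action. -/
theorem actionClosure_induction {s : Set (X ≃ᵢ X)} (hs : IsClosed s)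
    (h : ∀ g : G, toIsometryEquiv G X g ∈ s) (k : actionClosure G X) : (k : X ≃ᵢ X) ∈ s := by
  have hsub : closure (Set.range (toIsometryEquiv G X)) ⊆ s :=
    closure_minimal (Set.range_subset_iff.2 h) hs
  exact hsub k.2

theorem exists_dist_smul_lt_of_actionClosure (k : actionClosure G X) (x : X) {ε : ℝ} (hε : 0 < ε) :
    ∃ g : G, dist (g • x) (k • x) < ε := by
  by_contra! h
  have hk : ε ≤ dist (k • x) (k • x) :=
    actionClosure_induction (G := G) (s := {f : X ≃ᵢ X | ε ≤ dist (f x) (k • x)})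
      (isClosed_le continuous_const
        ((continuous_isometryEquiv_apply x).dist continuous_const)) h k
  rw [dist_self] at hk
  exact hk.not_gt hε

/-- A finite invariant measure is invariant under the closure of the action, as integrals of
bounded continuous functions depend continuously on the isometry. -/
theorem smulInvariantMeasure_actionClosure [CompactSpace X] [MeasurableSpace X] [BorelSpace X]
    (μ : Measure X) [IsFiniteMeasure μ] [SMulInvariantMeasure G X μ] :
    SMulInvariantMeasure (actionClosure G X) X μ := by
  have hmap (k : actionClosure G X) : μ.map (k • ·) = μ := by
    have hk : Measurable fun x : X => k • x := (continuous_const_smul k).measurable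
    refine ext_of_forall_integral_eq_of_IsFiniteMeasure fun F => ?_
    rw [integral_map hk.aemeasurable F.continuous.aestronglyMeasurable]
    refine actionClosure_induction (G := G) (s := {f : X ≃ᵢ X | ∫ x, F (f x) ∂μ = ∫ x, F x ∂μ})
      (isClosed_eq ?_ continuous_const) (fun g => ?_) k
    · refine continuous_of_dominated (bound := fun _ => ‖F‖) (fun f => ?_) (fun f => ?_)
        (integrable_const _) ?_
      · exact (F.continuous.comp f.continuous).aestronglyMeasurable
      · exact Eventually.of_forall fun x => F.norm_coe_le_norm _
      · exact Eventually.of_forall fun x =>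
          F.continuous.comp (continuous_isometryEquiv_apply x)
    · exact (measurePreserving_smul g μ).integral_comp'
        (f := (Homeomorph.smul g).toMeasurableEquiv) F
  refine ⟨fun k s hs => ?_⟩
  conv_rhs => rw [← hmap k]
  rw [Measure.map_apply (continuous_const_smul k).measurable hs]

end ActionClosure

/-! ### Orbit measures and couplings for a compact group -/

/-- If every orbit is `δ`-dense, then some group element depending measurably on `(x, x')` moves
`x` to within `δ` of `x'`. -/
theorem exists_measurable_dist_smul_lt {K X : Type*} [Group K] [TopologicalSpace K]
    [SecondCountableTopology K] [MeasurableSpace K] [MetricSpace X] [SecondCountableTopology X]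
    [MeasurableSpace X] [BorelSpace X] [MulAction K X] [ContinuousSMul K X] {δ : ℝ}
    (h : ∀ x x' : X, ∃ k : K, dist (k • x) x' < δ) :
    ∃ γ : X × X → K, Measurable γ ∧ ∀ z, dist (γ z • z.1) z.2 < δ := by
  classical
  let u := TopologicalSpace.denseSeq K
  have hu (z : X × X) : ∃ n, dist (u n • z.1) z.2 < δ := by
    have ho : IsOpen {k : K | dist (k • z.1) z.2 < δ} :=
      isOpen_lt (by fun_prop) continuous_const
    exact (TopologicalSpace.denseRange_denseSeq K).exists_mem_open ho (h z.1 z.2)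
  refine ⟨fun z => u (Nat.find (hu z)), ?_, fun z => Nat.find_spec (hu z)⟩
  refine Measurable.find (f := fun n _ => u n) (fun n => measurable_const) (fun n => ?_) hu
  exact (isOpen_lt (f := fun z : X × X => dist (u n • z.1) z.2)
    (by fun_prop) continuous_const).measurableSet

theorem continuous_smul_left {K X : Type*} [TopologicalSpace K] [TopologicalSpace X] [SMul K X]
    [ContinuousSMul K X] (x : X) : Continuous fun k : K => k • x := by fun_prop

section CompactGroup

variable (K : Type*) [Group K] [TopologicalSpace K] [IsTopologicalGroup K] [CompactSpace K]
  [MeasurableSpace K] [BorelSpace K]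

/-- Haar probability measure on a compact group. -/
noncomputable def haarProb : Measure K := Measure.haarMeasure ⊤

instance : (haarProb K).IsHaarMeasure := Measure.isHaarMeasure_haarMeasure _

instance : IsProbabilityMeasure (haarProb K) := ⟨Measure.haarMeasure_self (K₀ := ⊤)⟩

variable {K} {X : Type*} [MetricSpace X] [MeasurableSpace X] [BorelSpace X]
  [MulAction K X] [ContinuousSMul K X]

variable (K) in
/-- The law of `k • x` for a Haar distributed `k`. -/
noncomputable def orbitMeasure (x : X) : ProbabilityMeasure X :=
  ⟨(haarProb K).map fun k => k • x,
    Measure.isProbabilityMeasure_map (continuous_smul_left x).measurable.aemeasurable⟩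

theorem orbitMeasure_apply (x : X) {s : Set X} (hs : MeasurableSet s) :
    (orbitMeasure K x : Measure X) s = haarProb K {k | k • x ∈ s} :=
  Measure.map_apply (continuous_smul_left x).measurable hs

instance (x : X) : SMulInvariantMeasure K X (orbitMeasure K x : Measure X) where
  measure_preimage_smul g s hs := by
    rw [orbitMeasure_apply x (measurableSet_preimage (continuous_const_smul g).measurable hs),
      orbitMeasure_apply x hs]
    simpa [mul_smul, Set.preimage] using measure_preimage_mul (haarProb K) g {k | k • x ∈ s}

/-- Orbit measures are carried by their orbits, which are closed and pairwise disjoint. -/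
theorem exists_smul_eq_of_orbitMeasure_eq {x y : X} (h : orbitMeasure K x = orbitMeasure K y) :
    ∃ k : K, k • x = y := by
  have hs : MeasurableSet (MulAction.orbit K x) :=
    (isCompact_range (continuous_smul_left x)).isClosed.measurableSet
  have h₁ := orbitMeasure_apply (K := K) y hs
  rw [← h, orbitMeasure_apply x hs] at h₁
  have hx : {k : K | k • x ∈ MulAction.orbit K x} = Set.univ :=
    Set.eq_univ_of_forall fun k => ⟨k, rfl⟩
  rw [hx, measure_univ] at h₁
  have hne : {k : K | k • y ∈ MulAction.orbit K x}.Nonempty :=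
    nonempty_of_measure_ne_zero (h₁ ▸ one_ne_zero)
  obtain ⟨k, l, hl⟩ := hne
  exact ⟨k⁻¹ * l, by rw [mul_smul, inv_smul_eq_iff]; exact hl⟩

variable [SecondCountableTopology X]

/-- The law of `k⁻¹ • f z`, for `k` Haar distributed and `z` independent of `k`, does not change
when `f z` is moved along its orbit; it equals the law of `f z` if that is invariant. -/
theorem map_inv_smul_smul_eq {Z : Type*} [MeasurableSpace Z] (ρ : Measure Z)
    [IsProbabilityMeasure ρ] {γ : Z → K} (hγ : Measurable γ) {f : Z → X} (hf : Measurable f)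
    (μ : Measure X) [SMulInvariantMeasure K X μ] (hμ : ρ.map f = μ) :
    ((haarProb K).prod ρ).map (fun q => q.1⁻¹ • γ q.2 • f q.2) = μ := by
  have hm : Measurable fun q : K × Z => q.1⁻¹ • γ q.2 • f q.2 := by fun_prop
  have hm' : Measurable fun q : K × Z => q.1⁻¹ • f q.2 := by fun_prop
  ext s hs
  rw [Measure.map_apply hm hs, Measure.prod_apply_symm (hm hs)]
  -- The substitution `k ↦ γ z * k` removes `γ`.
  have h₁ (z : Z) : haarProb K ((fun k => (k, z)) ⁻¹' ((fun q : K × Z =>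
      q.1⁻¹ • γ q.2 • f q.2) ⁻¹' s)) = haarProb K ((fun k => (k, z)) ⁻¹' ((fun q : K × Z =>
      q.1⁻¹ • f q.2) ⁻¹' s)) := by
    rw [← measure_preimage_mul (haarProb K) (γ z)]
    congr 1
    ext k
    simp [mul_smul]
  simp_rw [h₁]
  rw [← Measure.prod_apply_symm (hm' hs), Measure.prod_apply (hm' hs)]
  have h₂ (k : K) : ρ (Prod.mk k ⁻¹' ((fun q : K × Z => q.1⁻¹ • f q.2) ⁻¹' s)) = μ s := by
    rw [← measure_preimage_smul μ k⁻¹ s, ← hμ,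
      Measure.map_apply hf ((continuous_const_smul k⁻¹).measurable hs)]
    rfl
  simp [h₂]

theorem exists_mem_couplings_dist_le [SecondCountableTopology K] [IsIsometricSMul K X] {δ : ℝ}
    (h : ∀ x x' : X, ∃ k : K, dist (k • x) x' < δ) (μ ν : ProbabilityMeasure X)
    [SMulInvariantMeasure K X (μ : Measure X)] [SMulInvariantMeasure K X (ν : Measure X)] :
    ∃ π ∈ couplings μ ν, ∀ᵐ z ∂(π : Measure (X × X)), dist z.1 z.2 ≤ δ := by
  obtain ⟨γ, hγ, hd⟩ := exists_measurable_dist_smul_lt h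
  let ρ : Measure (X × X) := (μ : Measure X).prod (ν : Measure X)
  let Φ : K × (X × X) → X × X := fun q => (q.1⁻¹ • γ q.2 • q.2.1, q.1⁻¹ • q.2.2)
  have hΦ : Measurable Φ := by fun_prop
  refine ⟨⟨((haarProb K).prod ρ).map Φ, Measure.isProbabilityMeasure_map hΦ.aemeasurable⟩,
    ⟨?_, ?_⟩, ?_⟩
  · rw [ProbabilityMeasure.coe_mk, Measure.map_map measurable_fst hΦ]
    exact map_inv_smul_smul_eq ρ hγ measurable_fst _ (by simp [ρ])
  · rw [ProbabilityMeasure.coe_mk, Measure.map_map measurable_snd hΦ]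
    simpa using! map_inv_smul_smul_eq ρ (γ := fun _ => (1 : K)) measurable_const
      measurable_snd (ν : Measure X) (by simp [ρ])
  · rw [ProbabilityMeasure.coe_mk, ae_map_iff hΦ.aemeasurable
      (isClosed_le (by fun_prop) continuous_const).measurableSet]
    refine Eventually.of_forall fun q => ?_
    simpa [Φ] using (hd q.2).le

end CompactGroup

/-! ### Wasserstein diameter and density of orbits -/

theorem wassersteinDist_le_of_mem_couplings {p : ℝ} (hp : 1 ≤ p) {X : Type*} [MetricSpace X]
    [MeasurableSpace X] {μ ν : ProbabilityMeasure X} {π : ProbabilityMeasure (X × X)}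
    (hπ : π ∈ couplings μ ν) {δ : ℝ}
    (h : ∀ᵐ z ∂(π : Measure (X × X)), dist z.1 z.2 ≤ δ) :
    wassersteinDist p μ ν ≤ ENNReal.ofReal δ := by
  have hp₀ : 0 < p := zero_lt_one.trans_le hp
  have hle : ∫⁻ z, edist z.1 z.2 ^ p ∂(π : Measure (X × X)) ≤ ENNReal.ofReal δ ^ p := by
    calc ∫⁻ z, edist z.1 z.2 ^ p ∂(π : Measure (X × X))
        ≤ ∫⁻ _, ENNReal.ofReal δ ^ p ∂(π : Measure (X × X)) := by
          refine lintegral_mono_ae (h.mono fun z hz => ?_)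
          rw [edist_dist]
          gcongr
      _ = ENNReal.ofReal δ ^ p := by simp
  calc wassersteinDist p μ ν ≤ (ENNReal.ofReal δ ^ p) ^ (1 / p) :=
        ENNReal.rpow_le_rpow ((iInf₂_le π hπ).trans hle) (by positivity)
    _ = ENNReal.ofReal δ := by
        rw [← ENNReal.rpow_mul, mul_one_div_cancel hp₀.ne', ENNReal.rpow_one]

theorem wassersteinDiam_le_of_exists_dist_smul_lt {p : ℝ} (hp : 1 ≤ p) {G : Type*} [Group G]
    {X : Type*} [MetricSpace X] [CompactSpace X] [MeasurableSpace X] [BorelSpace X]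
    [MulAction G X] [IsIsometricSMul G X] {δ : ℝ}
    (h : ∀ x x' : X, ∃ g : G, dist (g • x) x' < δ) :
    wassersteinDiam p (invariantWassersteinSpace p G X) ≤ ENNReal.ofReal δ := by
  refine iSup₂_le fun μ hμ => iSup₂_le fun ν hν => ?_
  have := hμ.2
  have := hν.2
  have := smulInvariantMeasure_actionClosure (G := G) (μ : Measure X)
  have := smulInvariantMeasure_actionClosure (G := G) (ν : Measure X)
  obtain ⟨π, hπ, hd⟩ := exists_mem_couplings_dist_le (K := actionClosure G X) (δ := δ)
    (fun x x' => (h x x').imp' (toActionClosure X) fun _ hg => hg) μ ν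
  exact wassersteinDist_le_of_mem_couplings hp hπ hd

/-- The orbits of a uniquely ergodic isometric action are dense. -/
theorem UniquelyErgodic.exists_dist_smul_lt {G : Type*} [Group G] {Y : Type*} [MetricSpace Y]
    [CompactSpace Y] [MeasurableSpace Y] [BorelSpace Y] [MulAction G Y] [IsIsometricSMul G Y]
    (hY : UniquelyErgodic G Y) (y y' : Y) {ε : ℝ} (hε : 0 < ε) :
    ∃ g : G, dist (g • y) y' < ε := by
  have hinv (y : Y) : SMulInvariantMeasure G Y (orbitMeasure (actionClosure G Y) y : Measure Y) :=
    ⟨fun g _ hs => measure_preimage_smul_of_nullMeasurableSet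
      (G := actionClosure G Y) hs.nullMeasurableSet (toActionClosure Y g)⟩
  obtain ⟨k, rfl⟩ := exists_smul_eq_of_orbitMeasure_eq (hY.unique (hinv y) (hinv y'))
  exact exists_dist_smul_lt_of_actionClosure k y hε

/-! ### Gromov-Hausdorff approximations -/

theorem exists_isGHApprox_of_ghDist_lt {G : Type*} [Group G] {X Y : Type*} [MetricSpace X]
    [MetricSpace Y] [MulAction G X] [MulAction G Y] {ε : ℝ}
    (h : ghDist G X Y < ENNReal.ofReal ε) :
    (∃ f : X → Y, IsGHApprox G ε f) ∧ ∃ f : Y → X, IsGHApprox G ε f := by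
  simp only [ghDist, iInf_lt_iff] at h
  obtain ⟨η, ⟨-, ⟨f, hf⟩, ⟨f', hf'⟩⟩, hlt⟩ := h
  have hle : η ≤ ε := ((ENNReal.ofReal_lt_ofReal_iff').1 hlt).1.le
  exact ⟨⟨f, ⟨fun a b => (hf.abs_dist_sub_le a b).trans hle,
      fun b => (hf.exists_dist_le b).imp fun _ ha => ha.trans hle⟩,
      fun g a => (hf.dist_smul_le g a).trans hle⟩,
    ⟨f', ⟨fun a b => (hf'.abs_dist_sub_le a b).trans hle,
      fun b => (hf'.exists_dist_le b).imp fun _ ha => ha.trans hle⟩,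
      fun g a => (hf'.dist_smul_le g a).trans hle⟩⟩

/-- An action that is approximated arbitrarily well by isometric actions is isometric. -/
theorem isIsometricSMul_of_isGHApprox {G : Type*} [Group G] {Y : Type*} [MetricSpace Y]
    [MulAction G Y] {X : ℕ → Type*} [∀ n, MetricSpace (X n)] [∀ n, MulAction G (X n)]
    [∀ n, IsIsometricSMul G (X n)]
    (h : ∀ ε : ℝ, 0 < ε → ∃ n, ∃ f : Y → X n, IsGHApprox G ε f) : IsIsometricSMul G Y := by
  refine ⟨fun g => Isometry.of_dist_eq fun a b => ?_⟩
  refine eq_of_forall_dist_le fun ε hε => ?_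
  obtain ⟨n, f, hf⟩ := h (ε / 4) (by positivity)
  have h₁ := abs_le.1 (hf.abs_dist_sub_le (g • a) (g • b))
  have h₂ := abs_le.1 (hf.abs_dist_sub_le a b)
  have h₃ := hf.dist_smul_le g a
  have h₄ := hf.dist_smul_le g b
  have h₅ := dist_smul g (f a) (f b)
  have h₆ := dist_triangle4 (g • f a) (f (g • a)) (f (g • b)) (g • f b)
  have h₇ := dist_triangle4 (f (g • a)) (g • f a) (g • f b) (f (g • b))
  rw [dist_comm (f (g • b))] at h₆
  rw [dist_comm (f (g • a)) (g • f a)] at h₇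
  rw [Real.dist_eq, abs_le]
  constructor <;> linarith

theorem IsGHApprox.exists_dist_smul_lt {G : Type*} [Group G] {X Y : Type*} [MetricSpace X]
    [MetricSpace Y] [MulAction G X] [MulAction G Y] {ε : ℝ} {f : X → Y} (hf : IsGHApprox G ε f)
    (hε : 0 < ε) (hY : ∀ y y' : Y, ∃ g : G, dist (g • y) y' < ε) (x x' : X) :
    ∃ g : G, dist (g • x) x' < 4 * ε := by
  obtain ⟨g, hg⟩ := hY (f x) (f x')
  refine ⟨g, ?_⟩
  have h₁ := abs_le.1 (hf.abs_dist_sub_le (g • x) x')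
  have h₂ := hf.dist_smul_le g x
  have h₃ := dist_triangle (f (g • x)) (g • f x) (f x')
  rw [dist_comm (f (g • x)) (g • f x)] at h₃
  linarith

end EquivariantGH

theorem corollary1p4
    {G : Type*} [Group G] [TopologicalSpace G] [IsTopologicalGroup G]
    [LocallyCompactSpace G] [SigmaCompactSpace G] [MeasurableSpace G] [BorelSpace G]
    (hG : EquivariantGH.IsAmenable G)
    {X : ℕ → Type*} [∀ n, MetricSpace (X n)] [∀ n, CompactSpace (X n)]
    [∀ n, MeasurableSpace (X n)] [∀ n, BorelSpace (X n)]
    [∀ n, MulAction G (X n)] [∀ n, IsIsometricSMul G (X n)]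
    {Y : Type*} [MetricSpace Y] [CompactSpace Y] [MeasurableSpace Y] [BorelSpace Y]
    [MulAction G Y]
    (hlim : Tendsto (fun n => EquivariantGH.ghDist G (X n) Y) atTop (𝓝 0))
    (hY : EquivariantGH.UniquelyErgodic G Y) (p : ℝ) (hp : 1 ≤ p) :
    Tendsto (fun n => EquivariantGH.wassersteinDiam p
      (EquivariantGH.invariantWassersteinSpace p G (X n))) atTop (𝓝 0) := by
  open EquivariantGH in
  have happrox (ε : ℝ) (hε : 0 < ε) : ∀ᶠ n in atTop, (∃ f : X n → Y, IsGHApprox G ε f) ∧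
      ∃ f : Y → X n, IsGHApprox G ε f :=
    (hlim.eventually_lt_const (ENNReal.ofReal_pos.2 hε)).mono fun _ hn =>
      exists_isGHApprox_of_ghDist_lt hn
  have : IsIsometricSMul G Y := EquivariantGH.isIsometricSMul_of_isGHApprox (X := X)
    fun ε hε => (happrox ε hε).exists.imp fun _ hn => hn.2
  rw [ENNReal.tendsto_nhds_zero]
  intro η hη
  -- Orbits in `X n` are `4 * ε`-dense once `X n` is `ε`-close to `Y`.
  obtain ⟨ε, hε, hεη⟩ : ∃ ε : ℝ, 0 < ε ∧ ENNReal.ofReal (4 * ε) ≤ η := by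
    obtain ⟨r, hr, hrη⟩ := ENNReal.lt_iff_exists_nnreal_btwn.1 hη
    refine ⟨r / 4, by have := ENNReal.coe_pos.1 hr; positivity, ?_⟩
    rw [mul_div_cancel₀ _ four_ne_zero, ENNReal.ofReal_coe_nnreal]
    exact hrη.le
  filter_upwards [happrox ε hε] with n hn
  obtain ⟨f, hf⟩ := hn.1
  exact (EquivariantGH.wassersteinDiam_le_of_exists_dist_smul_lt hp
    (hf.exists_dist_smul_lt hε fun y y' => hY.exists_dist_smul_lt y y' hε)).trans hεη
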